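/- Let $\Omega$ be a countably infinite set, equip $\mathrm{Sym}(\Omega)$ with the topology of pointwise convergence ($\Omega$ being discrete), and let $G\leq\mathrm{Sym}(\Omega)$ be a closed subgroup with the induced topology. For $A\subseteq\Omega$ let $G_A=\{g\in G:\ g(a)=a\ \text{for all } a\in A\}$ be its pointwise stabilizer. A unitary representation of $G$ is a homomorphism $\pi\colon G\to\mathcal U(\mathcal H)$ into the unitary group of a complex Hilbert space $\mathcal H$ that is continuous for the strong operator topology. Let $p_A$ be the orthogonal projection of $\mathcal H$ onto the closed subspace of $\pi(G_A)$-invariant vectors. The representation $\pi$ is called dissociated if $p_Ap_B=p_{A\cap B}$ for all finite $A,B\subseteq\Omega$. A Boolean p.m.p. action of $G$ is a homomorphism $\alpha\colon G\to\mathrm{Aut}(X,\mu)$ that is continuous for the weak topology, where $(X,\mu)$ is a standard probability space and $\mathrm{Aut}(X,\mu)$ is the group of invertible measure-preserving transformations of $(X,\mu)$ up to almost everywhere equality; the weak topology is the coarsest one making $T\mapsto\mu(TY\,\triangle\, Z)$ continuous for all measurable $Y,Z\subseteq X$. Let $\mathcal F_A$ be the $\sigma$-algebra of measurable sets $Y\subseteq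 X$ with $\mu(\alpha(g)Y\,\triangle\, Y)=0$ for every $g\in G_A$. The action $\alpha$ is called dissociated if for all finite $A,B\subseteq\Omega$ the $\sigma$-algebras $\mathcal F_A$ and $\mathcal F_B$ are independent conditionally on $\mathcal F_{A\cap B}$, that is, $\mathbb E[f\mid\mathcal F_A]=\mathbb E[f\mid\mathcal F_{A\cap B}]$ almost everywhere for every $\mathcal F_B$-measurable complex-valued $f\in L^2(X,\mu)$. Then the following are equivalent: 1. every unitary representation of $G$ is dissociated; 2. every Boolean p.m.p. action of $G$ is dissociated. -/

import Mathlib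

open MeasureTheory
open scoped symmDiff ENNReal

universe u v

noncomputable section

namespace Dissociation

/-! ### Permutation groups -/

/-- The topology of pointwise convergence on `Sym(Ω)`, where `Ω` is discrete. -/
instance permTopology (Ω : Type*) : TopologicalSpace (Equiv.Perm Ω) :=
  TopologicalSpace.induced (fun (g : Equiv.Perm Ω) (a : Ω) => g a)
    (@Pi.topologicalSpace Ω (fun _ => Ω) (fun _ => ⊥))

/-! ### Unitary representations -/

section Unitary

variable {Ω : Type*} {G : Subgroup (Equiv.Perm Ω)}
variable {H : Type*} [NormedAddCommGroup H] [InnerProductSpace ℂ H] [CompleteSpace H]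

/-- Continuity of a homomorphism into the unitary group for the strong operator topology. -/
def IsStronglyContinuous (π : G →* unitary (H →L[ℂ] H)) : Prop :=
  ∀ v : H, Continuous fun g : G => (π g : H →L[ℂ] H) v

/-- The space `H_A` of vectors invariant under the pointwise stabilizer `G_A`. -/
def invariants (π : G →* unitary (H →L[ℂ] H)) (A : Set Ω) : Submodule ℂ H where
  carrier := {v | ∀ g ∈ fixingSubgroup G A, (π g : H →L[ℂ] H) v = v}
  add_mem' := by
    intro v w hv hw g hg
    rw [map_add, hv g hg, hw g hg]
  zero_mem' := by
    intro g _
    exact map_zero _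
  smul_mem' := by
    intro c v hv g hg
    rw [map_smul, hv g hg]

theorem isClosed_invariants (π : G →* unitary (H →L[ℂ] H)) (A : Set Ω) :
    IsClosed (invariants π A : Set H) := by
  have h : (invariants π A : Set H) =
      ⋂ g ∈ fixingSubgroup G A, {v | (π g : H →L[ℂ] H) v = v} := by
    ext v
    simp [invariants]
  rw [h]
  exact isClosed_biInter fun g _ => isClosed_eq (π g : H →L[ℂ] H).continuous continuous_id

instance (π : G →* unitary (H →L[ℂ] H)) (A : Set Ω) : CompleteSpace (invariants π A) :=
  (isClosed_invariants π A).completeSpace_coe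

/-- The orthogonal projection `p_A` of `H` onto `H_A`. -/
def proj (π : G →* unitary (H →L[ℂ] H)) (A : Set Ω) : H →L[ℂ] H :=
  (invariants π A).starProjection

/-- `p_A p_B = p_{A ∩ B}` for all finite `A, B ⊆ Ω`. -/
def IsDissociatedRep (π : G →* unitary (H →L[ℂ] H)) : Prop :=
  ∀ A B : Set Ω, A.Finite → B.Finite → proj π A ∘L proj π B = proj π (A ∩ B)

end Unitary

/-! ### The group `Aut(X, μ)` -/

section Aut

variable {X : Type*} [MeasurableSpace X]

/-- Almost everywhere equality of measure-preserving self-maps. -/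
def aeSetoid (μ : Measure X) : Setoid {T : X → X // MeasurePreserving T μ μ} where
  r S T := S.1 =ᵐ[μ] T.1
  iseqv := ⟨fun _ => Filter.EventuallyEq.rfl, fun h => h.symm, fun h h' => h.trans h'⟩

/-- Measure-preserving self-maps of `(X, μ)`, up to almost everywhere equality. -/
def MPEnd (μ : Measure X) : Type _ := Quotient (aeSetoid μ)

/-- The monoid structure given by composition. -/
instance (μ : Measure X) : Monoid (MPEnd μ) where
  mul := Quotient.map₂ (fun S T => ⟨S.1 ∘ T.1, S.2.comp T.2⟩) (by
    intro S S' hS T T' hT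
    have h₁ : S.1 ∘ T.1 =ᵐ[μ] S'.1 ∘ T.1 := T.2.quasiMeasurePreserving.ae_eq_comp hS
    have h₂ : S'.1 ∘ T.1 =ᵐ[μ] S'.1 ∘ T'.1 := hT.fun_comp S'.1
    exact h₁.trans h₂)
  one := Quotient.mk _ ⟨id, MeasurePreserving.id μ⟩
  mul_assoc := by
    rintro ⟨R⟩ ⟨S⟩ ⟨T⟩
    rfl
  one_mul := by
    rintro ⟨T⟩
    rfl
  mul_one := by
    rintro ⟨T⟩
    rfl

/-- `Aut(X, μ)`: the measure-preserving transformations of `(X, μ)` that have a measure-preserving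
almost everywhere inverse, up to almost everywhere equality, with composition. On a standard
probability space these are the measure-preserving Borel isomorphisms between conull Borel sets,
up to almost everywhere equality. -/
def Aut (μ : Measure X) : Type _ := (MPEnd μ)ˣ

instance (μ : Measure X) : Group (Aut μ) := inferInstanceAs (Group (MPEnd μ)ˣ)

/-- `μ(T⁻¹Y ∆ Z)` for a measure-preserving map `T`. -/
def MPEnd.preimageDist {μ : Measure X} (T : MPEnd μ) (Y Z : Set X) : ℝ≥0∞ :=
  Quotient.lift (fun T : {T : X → X // MeasurePreserving T μ μ} => μ ((T.1 ⁻¹' Y) ∆ Z)) (by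
    intro S T h
    have hp : S.1 ⁻¹' Y =ᵐ[μ] T.1 ⁻¹' Y := h.preimage Y
    exact measure_congr (hp.symmDiff Filter.EventuallyEq.rfl)) T

/-- `μ(gY ∆ Z)` for `g ∈ Aut(X, μ)`; up to a null set, `gY` is the preimage of `Y` under `g⁻¹`. -/
def Aut.imageDist {μ : Measure X} (g : Aut μ) (Y Z : Set X) : ℝ≥0∞ :=
  MPEnd.preimageDist (Units.val g⁻¹) Y Z

/-- The weak topology on `Aut(X, μ)`: the coarsest one for which all the functions
`g ↦ μ(gY ∆ Z)`, with `Y, Z` measurable, are continuous. As the functions `μ(· ∆ Z)` induce the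
topology of the metric `μ(Y ∆ Z)` on the measure algebra, this is pointwise convergence on the
measure algebra. -/
instance weakTopology (μ : Measure X) : TopologicalSpace (Aut μ) :=
  ⨅ (Y : {Y : Set X // MeasurableSet Y}) (Z : {Z : Set X // MeasurableSet Z}),
    TopologicalSpace.induced (fun g : Aut μ => g.imageDist Y.1 Z.1) inferInstance

end Aut

/-! ### Boolean probability-measure-preserving actions -/

section Action

variable {Ω : Type*} {G : Subgroup (Equiv.Perm Ω)}
variable {X : Type*} [MeasurableSpace X] {μ : Measure X}

theorem MPEnd.preimageDist_compl {T : MPEnd μ} {Y : Set X} (h : T.preimageDist Y Y = 0) :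
    T.preimageDist Yᶜ Yᶜ = 0 := by
  induction T using Quotient.inductionOn with
  | h T =>
    have h' : μ ((T.1 ⁻¹' Y) ∆ Y) = 0 := h
    have : μ ((T.1 ⁻¹' Yᶜ) ∆ Yᶜ) = 0 := by
      rw [measure_symmDiff_eq_zero_iff] at h' ⊢
      exact h'.compl
    exact this

theorem MPEnd.preimageDist_iUnion {T : MPEnd μ} {Y : ℕ → Set X}
    (h : ∀ n, T.preimageDist (Y n) (Y n) = 0) :
    T.preimageDist (⋃ n, Y n) (⋃ n, Y n) = 0 := by
  induction T using Quotient.inductionOn with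
  | h T =>
    have h' : ∀ n, μ ((T.1 ⁻¹' Y n) ∆ Y n) = 0 := h
    have : μ ((T.1 ⁻¹' ⋃ n, Y n) ∆ ⋃ n, Y n) = 0 := by
      simp only [measure_symmDiff_eq_zero_iff, Set.preimage_iUnion] at h' ⊢
      exact Filter.EventuallyEq.countable_iUnion h'
    exact this

theorem MPEnd.preimageDist_empty (T : MPEnd μ) : T.preimageDist ∅ ∅ = 0 := by
  induction T using Quotient.inductionOn with
  | h T =>
    have : μ ((T.1 ⁻¹' ∅) ∆ ∅) = 0 := by simp
    exact this

/-- The σ-algebra `F_A` of the measurable sets `Y` with `μ(gY ∆ Y) = 0` for all `g ∈ G_A`. -/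
@[reducible] def invariantSigma (α : G →* Aut μ) (A : Set Ω) : MeasurableSpace X where
  MeasurableSet' Y := MeasurableSet Y ∧ ∀ g ∈ fixingSubgroup G A, (α g).imageDist Y Y = 0
  measurableSet_empty := ⟨MeasurableSet.empty, fun _ _ => MPEnd.preimageDist_empty _⟩
  measurableSet_compl _ h := ⟨h.1.compl, fun g hg => MPEnd.preimageDist_compl (h.2 g hg)⟩
  measurableSet_iUnion _ h := ⟨MeasurableSet.iUnion fun n => (h n).1,
    fun g hg => MPEnd.preimageDist_iUnion fun n => (h n).2 g hg⟩

/-- `F₁` and `F₃` are independent conditionally on `F₂`, where `F₂ ⊆ F₁ ∩ F₃`: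
`E[f | F₁] = E[f | F₂]` for every `F₃`-measurable `f` in the complex space `L²(X, μ)`. -/
def CondIndependent (μ : Measure X) (F₁ F₂ F₃ : MeasurableSpace X) : Prop :=
  ∀ f : X → ℂ, Measurable[F₃] f → MemLp f 2 μ → μ[f | F₁] =ᵐ[μ] μ[f | F₂]

/-- `F_A` and `F_B` are independent conditionally on `F_{A ∩ B}` for all finite `A, B ⊆ Ω`. -/
def IsDissociatedAction (α : G →* Aut μ) : Prop :=
  ∀ A B : Set Ω, A.Finite → B.Finite →
    CondIndependent μ (invariantSigma α A) (invariantSigma α (A ∩ B)) (invariantSigma α B)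

end Action

end Dissociation

end

/-! Both directions go through the Koopman representation on the full complex space L²(X, μ). Its
`G_A`-invariant vectors are the `F_A`-measurable functions, so `p_A` is conditional expectation onto
`F_A`. Conditional independence says that `p_A` and `p_{A ∩ B}` agree on the range of `p_B`; since
`p_{A ∩ B} p_B = p_{A ∩ B}`, this is `p_A p_B = p_{A ∩ B}`. Hence an action is dissociated exactly
when its Koopman representation is, and (1) implies (2).

For (2) implies (1), dissociation passes to subrepresentations and can be tested on cyclic ones,
which are separable because `G` is second countable. It remains to embed a separable representation
in the Koopman representation of some action, and the Gaussian action does this. Given a Hilbert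
basis, send its vectors to the coordinates of a product of standard complex Gaussians; this extends
to a complex-linear isometry Φ into L². The law of Φ(v) is a circular Gaussian depending only on
‖v‖, and Φ sends orthonormal families to independent ones. So for an isometry U the map with
coordinates Φ(U eᵢ) preserves the product measure (`measurePreserving_gaussianMap`), and Φ
intertwines U with composition by that map (`compMeasurePreserving_gaussianEmbedding`). Continuity
for the weak topology comes from convergence in measure of the coordinates. -/

noncomputable section

namespace Dissociation

/-! ### Intertwiners, cyclic subrepresentations and separability. -/

section Representations

variable {Ω : Type*} {G : Subgroup (Equiv.Perm Ω)}
variable {H : Type*} [NormedAddCommGroup H] [InnerProductSpace ℂ H] [CompleteSpace H]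
variable {K : Type*} [NormedAddCommGroup K] [InnerProductSpace ℂ K] [CompleteSpace K]

/-- A homomorphism into the monoid of linear isometries of a Hilbert space is unitary. -/
def unitaryOfIsometries {Γ : Type*} [Group Γ] (ρ : Γ →* (H →ₗᵢ[ℂ] H)) :
    Γ →* unitary (H →L[ℂ] H) :=
  Unitary.linearIsometryEquiv.symm.toMonoidHom.comp
    { toFun := fun g =>
        { (ρ g).toLinearMap with
          invFun := ρ g⁻¹
          left_inv := fun x => by
            change (ρ g⁻¹ * ρ g) x = x
            rw [← map_mul, inv_mul_cancel, map_one]; rfl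
          right_inv := fun x => by
            change (ρ g * ρ g⁻¹) x = x
            rw [← map_mul, mul_inv_cancel, map_one]; rfl
          norm_map' := (ρ g).norm_map }
      map_one' := by
        ext x
        change ρ 1 x = x
        rw [map_one]; rfl
      map_mul' := fun g h => by
        ext x
        change ρ (g * h) x = ρ g (ρ h x)
        rw [map_mul]; rfl }

theorem invariants_mono (π : G →* unitary (H →L[ℂ] H)) {A B : Set Ω} (h : A ⊆ B) :
    invariants π A ≤ invariants π B :=
  fun _ hv g hg => hv g (fixingSubgroup_antitone G Ω h hg)

theorem unitary_mul_apply {Γ : Type*} [Group Γ] (π : Γ →* unitary (H →L[ℂ] H)) (g h : Γ) (v : H) :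
    (π (g * h) : H →L[ℂ] H) v = (π g : H →L[ℂ] H) ((π h : H →L[ℂ] H) v) := by
  rw [map_mul]; rfl

theorem unitary_one_apply {Γ : Type*} [Group Γ] (π : Γ →* unitary (H →L[ℂ] H)) (v : H) :
    (π 1 : H →L[ℂ] H) v = v := by
  rw [map_one]; rfl

theorem unitary_inv_apply_self {Γ : Type*} [Group Γ] (π : Γ →* unitary (H →L[ℂ] H)) (g : Γ)
    (v : H) : (π g : H →L[ℂ] H) ((π g⁻¹ : H →L[ℂ] H) v) = v := by
  rw [← unitary_mul_apply, mul_inv_cancel, unitary_one_apply]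

theorem unitary_inner_map_map {Γ : Type*} [Group Γ] (π : Γ →* unitary (H →L[ℂ] H)) (g : Γ)
    (v w : H) : inner ℂ ((π g : H →L[ℂ] H) v) ((π g : H →L[ℂ] H) w) = inner ℂ v w :=
  (Unitary.linearIsometryEquiv (π g)).inner_map_map v w

theorem unitary_norm_map {Γ : Type*} [Group Γ] (π : Γ →* unitary (H →L[ℂ] H)) (g : Γ)
    (v : H) : ‖(π g : H →L[ℂ] H) v‖ = ‖v‖ :=
  (Unitary.linearIsometryEquiv (π g)).norm_map v

/-- The adjoint of an isometric intertwiner maps invariant vectors to invariant vectors. -/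
theorem adjoint_mem_invariants {π : G →* unitary (H →L[ℂ] H)} {ρ : G →* unitary (K →L[ℂ] K)}
    (V : K →ₗᵢ[ℂ] H) (hV : ∀ g x, V ((ρ g : K →L[ℂ] K) x) = (π g : H →L[ℂ] H) (V x))
    {A : Set Ω} {y : H} (hy : y ∈ invariants π A) :
    V.toContinuousLinearMap.adjoint y ∈ invariants ρ A := by
  intro g hg
  refine ext_inner_right ℂ fun x => ?_
  have h : inner ℂ ((ρ g : K →L[ℂ] K) (V.toContinuousLinearMap.adjoint y)) x =
      inner ℂ (V.toContinuousLinearMap.adjoint y) ((ρ g⁻¹ : K →L[ℂ] K) x) := by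
    rw [← unitary_inner_map_map ρ g _ ((ρ g⁻¹ : K →L[ℂ] K) x), unitary_inv_apply_self]
  rw [h, ContinuousLinearMap.adjoint_inner_left, ContinuousLinearMap.adjoint_inner_left]
  change inner ℂ y (V _) = inner ℂ y (V x)
  rw [hV, ← unitary_inner_map_map π g, unitary_inv_apply_self, hy g hg]

/-- Isometric intertwiners commute with the projections onto invariant vectors. -/
theorem map_proj {π : G →* unitary (H →L[ℂ] H)} {ρ : G →* unitary (K →L[ℂ] K)}
    (V : K →ₗᵢ[ℂ] H) (hV : ∀ g x, V ((ρ g : K →L[ℂ] K) x) = (π g : H →L[ℂ] H) (V x))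
    (A : Set Ω) (x : K) : V (proj ρ A x) = proj π A (V x) := by
  symm
  refine Submodule.eq_starProjection_of_mem_of_inner_eq_zero ?_ ?_
  · intro g hg
    rw [← hV]
    exact congrArg V (Submodule.starProjection_apply_mem (invariants ρ A) x g hg)
  · intro y hy
    rw [← map_sub]
    have h := ContinuousLinearMap.adjoint_inner_right V.toContinuousLinearMap (x - proj ρ A x) y
    change _ = inner ℂ (V _) y at h
    -- The adjoint of `V` moves the test vector into the invariants of `ρ`, which are orthogonal to
    -- `x - proj ρ A x`.
    rw [← h]
    exact Submodule.starProjection_inner_eq_zero x _ (adjoint_mem_invariants V hV hy)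

/-- A representation that embeds isometrically into a dissociated one is dissociated. -/
theorem IsDissociatedRep.of_intertwiner {π : G →* unitary (H →L[ℂ] H)}
    {ρ : G →* unitary (K →L[ℂ] K)} (V : K →ₗᵢ[ℂ] H)
    (hV : ∀ g x, V ((ρ g : K →L[ℂ] K) x) = (π g : H →L[ℂ] H) (V x))
    (h : IsDissociatedRep π) : IsDissociatedRep ρ := by
  intro A B hA hB
  ext x
  apply V.injective
  rw [ContinuousLinearMap.comp_apply, map_proj V hV, map_proj V hV, map_proj V hV,
    ← h A B hA hB, ContinuousLinearMap.comp_apply]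

/-- The cyclic subspace generated by a vector. -/
def cyclicSubspace (π : G →* unitary (H →L[ℂ] H)) (v : H) : Submodule ℂ H :=
  (Submodule.span ℂ (Set.range fun g => (π g : H →L[ℂ] H) v)).topologicalClosure

theorem mem_cyclicSubspace (π : G →* unitary (H →L[ℂ] H)) (v : H) : v ∈ cyclicSubspace π v :=
  Submodule.le_topologicalClosure _ (Submodule.subset_span ⟨1, unitary_one_apply π v⟩)

theorem apply_mem_cyclicSubspace (π : G →* unitary (H →L[ℂ] H)) (v : H) (g : G) {x : H}
    (hx : x ∈ cyclicSubspace π v) : (π g : H →L[ℂ] H) x ∈ cyclicSubspace π v := by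
  have hmap : Submodule.span ℂ (Set.range fun g => (π g : H →L[ℂ] H) v) ≤
      (Submodule.span ℂ (Set.range fun g => (π g : H →L[ℂ] H) v)).comap
        (π g : H →L[ℂ] H).toLinearMap := by
    rw [Submodule.span_le]
    rintro _ ⟨h, rfl⟩
    exact Submodule.subset_span ⟨g * h, unitary_mul_apply π g h v⟩
  exact map_mem_closure (π g : H →L[ℂ] H).continuous hx hmap

instance (π : G →* unitary (H →L[ℂ] H)) (v : H) : CompleteSpace (cyclicSubspace π v) :=
  (Submodule.isClosed_topologicalClosure _).completeSpace_coe

/-- The representation on the cyclic subspace generated by a vector. -/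
def cyclicRep (π : G →* unitary (H →L[ℂ] H)) (v : H) :
    G →* unitary (cyclicSubspace π v →L[ℂ] cyclicSubspace π v) :=
  unitaryOfIsometries
    { toFun := fun g =>
        { (π g : H →L[ℂ] H).toLinearMap.restrict
            (fun _ hx => apply_mem_cyclicSubspace π v g hx) with
          norm_map' := fun x => unitary_norm_map π g x }
      map_one' := by
        ext x
        exact unitary_one_apply π (x : H)
      map_mul' := fun g h => by
        ext x
        exact unitary_mul_apply π g h (x : H) }

theorem IsStronglyContinuous.cyclicRep {π : G →* unitary (H →L[ℂ] H)}
    (h : IsStronglyContinuous π) (v : H) : IsStronglyContinuous (cyclicRep π v) :=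
  fun x => Continuous.subtype_mk (h x) _

/-- A representation is dissociated if its cyclic subrepresentations are. -/
theorem IsDissociatedRep.of_cyclicRep {π : G →* unitary (H →L[ℂ] H)}
    (h : ∀ v, IsDissociatedRep (cyclicRep π v)) : IsDissociatedRep π := by
  intro A B hA hB
  ext v
  let V := (cyclicSubspace π v).subtypeₗᵢ
  have hV : ∀ g x, V ((Dissociation.cyclicRep π v g :
      cyclicSubspace π v →L[ℂ] cyclicSubspace π v) x) = (π g : H →L[ℂ] H) (V x) :=
    fun g x => rfl
  have hv : V ⟨v, mem_cyclicSubspace π v⟩ = v := rfl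
  rw [← hv, ContinuousLinearMap.comp_apply, ← map_proj V hV, ← map_proj V hV, ← map_proj V hV,
    ← h v A B hA hB, ContinuousLinearMap.comp_apply]

theorem secondCountableTopology_perm (Ω : Type*) [Countable Ω] :
    SecondCountableTopology (Equiv.Perm Ω) := by
  let _ : TopologicalSpace Ω := ⊥
  have : DiscreteTopology Ω := ⟨rfl⟩
  exact TopologicalSpace.secondCountableTopology_induced _ _ _

theorem separableSpace_cyclicSubspace [Countable Ω] {π : G →* unitary (H →L[ℂ] H)}
    (h : IsStronglyContinuous π) (v : H) :
    TopologicalSpace.SeparableSpace (cyclicSubspace π v) := by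
  have := secondCountableTopology_perm Ω
  have : SecondCountableTopology G :=
    TopologicalSpace.Subtype.secondCountableTopology (G : Set (Equiv.Perm Ω))
  have h₁ : TopologicalSpace.IsSeparable (Set.range fun g => (π g : H →L[ℂ] H) v) :=
    TopologicalSpace.isSeparable_range (h v)
  exact (h₁.span (R := ℂ)).closure.separableSpace

end Representations

/-! ### The Koopman representation and conditional expectations. -/

section Koopman

variable {Ω : Type*} {G : Subgroup (Equiv.Perm Ω)}
variable {X : Type*} [MeasurableSpace X] {μ : Measure X}

/-- Composition with a measure-preserving map, as an isometry of `L²`. -/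
def MPEnd.koopman (T : MPEnd μ) : Lp ℂ 2 μ →ₗᵢ[ℂ] Lp ℂ 2 μ :=
  Quotient.lift (fun T : {T : X → X // MeasurePreserving T μ μ} =>
    Lp.compMeasurePreservingₗᵢ ℂ T.1 T.2) (by
      intro S T h
      ext1 f
      refine Lp.ext ?_
      exact (Lp.coeFn_compMeasurePreserving f S.2).trans
        ((h.fun_comp f).trans (Lp.coeFn_compMeasurePreserving f T.2).symm)) T

theorem MPEnd.koopman_one : (1 : MPEnd μ).koopman = 1 := by
  ext1 f
  exact Lp.compMeasurePreserving_id_apply f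

/-- Composition acts contravariantly on functions, which is why the Koopman representation uses `(α
g)⁻¹`. -/
theorem MPEnd.koopman_mul (S T : MPEnd μ) : (S * T).koopman = T.koopman * S.koopman := by
  induction S using Quotient.inductionOn with
  | h S =>
    induction T using Quotient.inductionOn with
    | h T =>
      ext1 f
      exact Lp.compMeasurePreserving_comp_apply f S.2 T.2

/-- The Koopman representation of a Boolean p.m.p. action. -/
def koopman (α : G →* Aut μ) : G →* unitary (Lp ℂ 2 μ →L[ℂ] Lp ℂ 2 μ) :=
  unitaryOfIsometries
    { toFun := fun g => (Units.val (α g)⁻¹).koopman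
      map_one' := by
        have h : (α 1)⁻¹ = 1 := by rw [map_one, inv_one]
        exact (congrArg (fun a : Aut μ => (Units.val a).koopman) h).trans MPEnd.koopman_one
      map_mul' := fun g h => by
        have h : (α (g * h))⁻¹ = (α h)⁻¹ * (α g)⁻¹ := by rw [map_mul, mul_inv_rev]
        exact (congrArg (fun a : Aut μ => (Units.val a).koopman) h).trans
          (MPEnd.koopman_mul _ _) }

theorem koopman_apply (α : G →* Aut μ) (g : G) (f : Lp ℂ 2 μ) :
    (koopman α g : Lp ℂ 2 μ →L[ℂ] Lp ℂ 2 μ) f = (Units.val (α g)⁻¹).koopman f := rfl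

/-- A representative of `α(g)⁻¹`. -/
theorem exists_inverse_representative (α : G →* Aut μ) (g : G) :
    ∃ T : X → X, ∃ hT : MeasurePreserving T μ μ,
      (∀ Y Z, (α g).imageDist Y Z = μ ((T ⁻¹' Y) ∆ Z)) ∧
      ∀ f : Lp ℂ 2 μ, (koopman α g : Lp ℂ 2 μ →L[ℂ] Lp ℂ 2 μ) f =
        Lp.compMeasurePreserving T hT f := by
  obtain ⟨T, hT⟩ := Quotient.exists_rep (s := aeSetoid μ) (Units.val (α g)⁻¹ : MPEnd μ)
  refine ⟨T.1, T.2, fun Y Z => ?_, fun f => ?_⟩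
  · rw [Aut.imageDist, ← hT]; rfl
  · rw [koopman_apply, ← hT]; rfl

theorem invariantSigma_le (α : G →* Aut μ) (A : Set Ω) :
    invariantSigma α A ≤ (inferInstance : MeasurableSpace X) := fun _ h => h.1

theorem mem_invariants_koopman {α : G →* Aut μ} {A : Set Ω} {f : Lp ℂ 2 μ} :
    f ∈ invariants (koopman α) A ↔ AEStronglyMeasurable[invariantSigma α A] f μ := by
  constructor
  · intro hf
    have hm : Measurable f := (Lp.stronglyMeasurable f).measurable
    have : Measurable[invariantSigma α A] f := by
      intro s hs
      refine ⟨hm hs, fun g hg => ?_⟩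
      obtain ⟨T, hT, hdist, hk⟩ := exists_inverse_representative α g
      have h := Lp.coeFn_compMeasurePreserving f hT
      rw [← hk, hf g hg] at h
      rw [hdist, measure_symmDiff_eq_zero_iff, ← Set.preimage_comp]
      exact (h.preimage s).symm
    exact (Measurable.stronglyMeasurable this).aestronglyMeasurable
  · rintro ⟨f', hf', hff'⟩ g hg
    obtain ⟨T, hT, hdist, hk⟩ := exists_inverse_representative α g
    rw [hk]
    refine Lp.ext ((Lp.coeFn_compMeasurePreserving f hT).trans ?_)
    refine (hT.quasiMeasurePreserving.ae_eq_comp hff').trans (Filter.EventuallyEq.trans ?_ hff'.symm)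
    -- Countably many measurable sets separate the points of ℂ, so almost invariance of each
    -- preimage gives almost invariance of `f'`.
    refine Filter.EventuallyEq.of_forall_separating_preimage MeasurableSet fun U hU => ?_
    rw [← measure_symmDiff_eq_zero_iff, Set.preimage_comp, ← hdist]
    exact (hf'.measurable hU).2 g hg

theorem invariants_koopman (α : G →* Aut μ) (A : Set Ω) :
    invariants (koopman α) A = lpMeas ℂ ℂ (invariantSigma α A) 2 μ := by
  ext f
  rw [mem_invariants_koopman, mem_lpMeas_iff_aestronglyMeasurable]

/-- Both sides are the orthogonal projection onto the same closed subspace of L², by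
`invariants_koopman`. -/
theorem proj_koopman_ae_eq_condExp [IsFiniteMeasure μ] (α : G →* Aut μ) (A : Set Ω) {f : X → ℂ}
    (hf : MemLp f 2 μ) : proj (koopman α) A hf.toLp =ᵐ[μ] μ[f | invariantSigma α A] := by
  have hm := invariantSigma_le α A
  refine Filter.EventuallyEq.trans (Filter.EventuallyEq.of_eq ?_)
    (hf.condExpL2_ae_eq_condExp (𝕜 := ℂ) hm)
  congr 2
  refine Submodule.eq_starProjection_of_mem_of_inner_eq_zero (K := invariants (koopman α) A) ?_ ?_
  · rw [invariants_koopman]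
    exact Submodule.coe_mem _
  · intro w hw
    rw [invariants_koopman] at hw
    have : Fact (invariantSigma α A ≤ (inferInstance : MeasurableSpace X)) := ⟨hm⟩
    exact Submodule.starProjection_inner_eq_zero (K := lpMeas ℂ ℂ (invariantSigma α A) 2 μ)
      hf.toLp w hw

theorem IsDissociatedRep.isDissociatedAction [IsFiniteMeasure μ] {α : G →* Aut μ}
    (h : IsDissociatedRep (koopman α)) : IsDissociatedAction α := by
  intro A B hA hB f hfm hf
  have hmem : hf.toLp ∈ invariants (koopman α) B := by
    rw [mem_invariants_koopman]
    exact ⟨f, hfm.stronglyMeasurable, hf.coeFn_toLp⟩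
  have h₁ := congrArg (fun P => P hf.toLp) (h A B hA hB)
  have h₂ : proj (koopman α) B hf.toLp = hf.toLp :=
    Submodule.starProjection_eq_self_iff.mpr hmem
  simp only [ContinuousLinearMap.comp_apply, h₂] at h₁
  have h₃ := proj_koopman_ae_eq_condExp α A hf
  rw [h₁] at h₃
  exact h₃.symm.trans (proj_koopman_ae_eq_condExp α (A ∩ B) hf)

theorem IsDissociatedAction.isDissociatedRep [IsFiniteMeasure μ] {α : G →* Aut μ}
    (h : IsDissociatedAction α) : IsDissociatedRep (koopman α) := by
  intro A B hA hB
  ext1 F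
  rw [ContinuousLinearMap.comp_apply]
  have hb : proj (koopman α) B F ∈ invariants (koopman α) B :=
    Submodule.starProjection_apply_mem _ F
  obtain ⟨f, hfm, hf⟩ := mem_invariants_koopman.mp hb
  have hf2 : MemLp f 2 μ := (memLp_congr_ae hf).mp (Lp.memLp _)
  have hfb : hf2.toLp = proj (koopman α) B F :=
    Lp.ext (hf2.coeFn_toLp.trans hf.symm)
  -- Conditional independence applies to an `F_B`-measurable representative of `p_B F`.
  have h₁ : proj (koopman α) A (proj (koopman α) B F) =
      proj (koopman α) (A ∩ B) (proj (koopman α) B F) := by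
    rw [← hfb]
    refine Lp.ext ((proj_koopman_ae_eq_condExp α A hf2).trans ?_)
    exact (h A B hA hB f hfm.measurable hf2).trans
      (proj_koopman_ae_eq_condExp α (A ∩ B) hf2).symm
  rw [h₁]
  have hle := invariants_mono (koopman α) (Set.inter_subset_right : A ∩ B ⊆ B)
  exact congrArg (fun P => P F) (Submodule.starProjection_comp_starProjection_of_le hle)

theorem imageDist_continuous {α : G →* Aut μ} (hα : Continuous α) {Y Z : Set X}
    (hY : MeasurableSet Y) (hZ : MeasurableSet Z) :
    Continuous fun g => (α g).imageDist Y Z := by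
  have h : Continuous fun g : Aut μ => g.imageDist Y Z := by
    refine continuous_iff_le_induced.mpr ?_
    exact (iInf_le _ (⟨Y, hY⟩ : {Y : Set X // MeasurableSet Y})).trans
      (iInf_le _ (⟨Z, hZ⟩ : {Z : Set X // MeasurableSet Z}))
  exact h.comp hα

theorem continuous_of_imageDist {α : G →* Aut μ}
    (h : ∀ Y Z, MeasurableSet Y → MeasurableSet Z → Continuous fun g => (α g).imageDist Y Z) :
    Continuous α := by
  refine continuous_iInf_rng.mpr fun Y => continuous_iInf_rng.mpr fun Z => ?_
  exact continuous_induced_rng.mpr (h Y.1 Z.1 Y.2 Z.2)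

/-- The Koopman representation of a continuous action is strongly continuous. -/
theorem isStronglyContinuous_koopman [IsFiniteMeasure μ] {α : G →* Aut μ} (hα : Continuous α) :
    IsStronglyContinuous (koopman α) := by
  choose T hT hdist hk using fun g => exists_inverse_representative α g
  intro f
  refine Lp.induction (p := 2) ENNReal.ofNat_ne_top
    (fun f => Continuous fun g : G => (koopman α g : Lp ℂ 2 μ →L[ℂ] Lp ℂ 2 μ) f) ?_ ?_ ?_ f
  · intro c s hs hμs
    simp only [hk, Lp.simpleFunc.coe_indicatorConst, Lp.indicatorConstLp_compMeasurePreserving]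
    refine continuous_indicatorConstLp_set ENNReal.ofNat_ne_top fun h => ?_
    simp only [← hdist]
    -- Taking the preimage of `s` under the representative of `α(h)⁻¹` as comparison set makes the
    -- limit at `h` equal to zero.
    have hc := (imageDist_continuous hα hs (hs.preimage (hT h).measurable)).tendsto h
    simpa [hdist] using hc
  · intro f g hf hg _ ihf ihg
    simp only [map_add]
    exact ihf.add ihg
  · refine isClosed_of_closure_subset fun f hf => ?_
    rw [Metric.mem_closure_iff] at hf
    -- The operators are isometric, so approximating the vector approximates its orbit map uniformly
    -- in `g`.
    refine continuous_of_uniform_approx_of_continuous fun u hu => ?_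
    obtain ⟨ε, hε, hu⟩ := Metric.mem_uniformity_dist.mp hu
    obtain ⟨f', hf', hd⟩ := hf ε hε
    refine ⟨_, hf', fun g => hu ?_⟩
    rwa [dist_eq_norm, ← map_sub, unitary_norm_map, ← dist_eq_norm]

end Koopman

/-! ### From convergence in measure to convergence in the measure algebra. -/

section Convergence

open Filter Topology

variable {X : Type*} [MeasurableSpace X] {μ : Measure X} [IsFiniteMeasure μ]

theorem measure_sdiff_comm {s t : Set X} (hs : MeasurableSet s) (ht : MeasurableSet t)
    (h : μ s = μ t) : μ (t \ s) = μ (s \ t) := by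
  have h₁ := measure_sdiff_add_inter (μ := μ) t hs
  have h₂ := measure_sdiff_add_inter (μ := μ) s ht
  rw [Set.inter_comm] at h₂
  exact (ENNReal.add_left_inj (measure_ne_top μ (t ∩ s))).mp (by rw [h₁, h₂, h])

/-- If `fₙ → f` in measure and all of them have the same law, then the preimages of a closed set
converge in the measure algebra. -/
theorem tendsto_measure_symmDiff_preimage_of_isClosed {E : Type*} [PseudoEMetricSpace E]
    [MeasurableSpace E] [OpensMeasurableSpace E] {β : Type*} {l : Filter β} {f : β → X → E}
    {f₀ : X → E} (hf : ∀ n, Measurable (f n)) (hf₀ : Measurable f₀)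
    (hlaw : ∀ n, μ.map (f n) = μ.map f₀) (h : TendstoInMeasure μ f l f₀) {C : Set E}
    (hC : IsClosed C) : Tendsto (fun n => μ ((f n ⁻¹' C) ∆ (f₀ ⁻¹' C))) l (𝓝 0) := by
  have hmeas : ∀ n, μ (f n ⁻¹' C) = μ (f₀ ⁻¹' C) := fun n => by
    rw [← Measure.map_apply (hf n) hC.measurableSet, hlaw, Measure.map_apply hf₀ hC.measurableSet]
  -- Equal laws give the two one-sided differences the same measure, so only one of them has to be
  -- estimated.
  have hdiff : ∀ n, μ ((f n ⁻¹' C) ∆ (f₀ ⁻¹' C)) = 2 * μ ((f n ⁻¹' C) \ (f₀ ⁻¹' C)) := fun n => by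
    rw [measure_symmDiff_eq ((hf n) hC.measurableSet).nullMeasurableSet
      (hf₀ hC.measurableSet).nullMeasurableSet, two_mul,
      measure_sdiff_comm (hf n hC.measurableSet) (hf₀ hC.measurableSet) (hmeas n)]
  simp only [hdiff]
  rw [show (0 : ℝ≥0∞) = 2 * 0 by simp]
  refine ENNReal.Tendsto.const_mul ?_ (Or.inr (by norm_num))
  rw [ENNReal.tendsto_nhds_zero]
  intro ε hε
  have hthick : Tendsto (fun δ => μ.map f₀ (Metric.thickening δ C)) (𝓝[>] 0)
      (𝓝 (μ.map f₀ C)) :=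
    tendsto_measure_thickening_of_isClosed ⟨1, one_pos, measure_ne_top _ _⟩ hC
  have hε2 : 0 < ε / 2 := ENNReal.half_pos hε.ne'
  obtain ⟨δ, hδ, hδ0⟩ := ((hthick.eventually_lt_const
    (ENNReal.lt_add_right (measure_ne_top _ _) hε2.ne')).and self_mem_nhdsWithin).exists
  have hδ0 : 0 < δ := hδ0
  have hsmall : μ (f₀ ⁻¹' (Metric.thickening δ C \ C)) ≤ ε / 2 := by
    rw [← Measure.map_apply hf₀
      (Metric.isOpen_thickening.measurableSet.diff hC.measurableSet),
      measure_sdiff (Metric.self_subset_thickening hδ0 C) hC.measurableSet.nullMeasurableSet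
        (measure_ne_top _ _)]
    exact tsub_le_iff_left.mpr hδ.le
  filter_upwards [(ENNReal.tendsto_nhds_zero.mp (h (ENNReal.ofReal δ) (by simpa using hδ0)))
    (ε / 2) hε2] with n hn
  -- If `f n x` lies in `C` and `f₀ x` does not, then either they are at least δ apart or `f₀ x`
  -- lies in the thin shell around `C`.
  have hsub : (f n ⁻¹' C) \ (f₀ ⁻¹' C) ⊆
      {x | ENNReal.ofReal δ ≤ edist (f n x) (f₀ x)} ∪ f₀ ⁻¹' (Metric.thickening δ C \ C) := by
    rintro x ⟨hx, hx₀⟩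
    by_cases hd : ENNReal.ofReal δ ≤ edist (f n x) (f₀ x)
    · exact Or.inl hd
    · refine Or.inr ⟨?_, hx₀⟩
      rw [Metric.mem_thickening_iff_exists_edist_lt]
      exact ⟨f n x, hx, by rw [edist_comm]; exact not_le.mp hd⟩
  calc μ ((f n ⁻¹' C) \ (f₀ ⁻¹' C)) ≤ _ := measure_mono hsub
    _ ≤ _ := measure_union_le _ _
    _ ≤ ε / 2 + ε / 2 := add_le_add hn hsmall
    _ = ε := ENNReal.add_halves ε

/-- The sets whose preimages converge in the measure algebra are stable under countable unions. -/
theorem tendsto_measure_symmDiff_preimage_iUnion {β : Type*} {l : Filter β} {S : β → X → X}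
    {S₀ : X → X} (hS : ∀ n, MeasurePreserving (S n) μ μ) (hS₀ : MeasurePreserving S₀ μ μ)
    {Y : ℕ → Set X} (hY : ∀ k, MeasurableSet (Y k))
    (h : ∀ k, Tendsto (fun n => μ ((S n ⁻¹' Y k) ∆ (S₀ ⁻¹' Y k))) l (𝓝 0)) :
    Tendsto (fun n => μ ((S n ⁻¹' ⋃ k, Y k) ∆ (S₀ ⁻¹' ⋃ k, Y k))) l (𝓝 0) := by
  rw [ENNReal.tendsto_nhds_zero]
  intro ε hε
  have hε3 : 0 < ε / 3 := ENNReal.div_pos hε.ne' (by norm_num)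
  have hYacc : ∀ N, MeasurableSet (Set.accumulate Y N) := fun N =>
    MeasurableSet.iUnion fun k => MeasurableSet.iUnion fun _ => hY k
  have hacc : Tendsto (fun N => μ ((⋃ k, Y k) \ Set.accumulate Y N)) atTop (𝓝 0) := by
    have h₁ := ENNReal.Tendsto.sub (tendsto_const_nhds (x := μ (⋃ k, Y k)))
      (tendsto_measure_iUnion_accumulate (μ := μ) (f := Y)) (Or.inl (measure_ne_top _ _))
    rw [tsub_self] at h₁
    refine h₁.congr fun N => ?_
    rw [measure_sdiff (Set.accumulate_subset_iUnion N)
      (hYacc N).nullMeasurableSet (measure_ne_top _ _)]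
  obtain ⟨N, hN⟩ := (ENNReal.tendsto_nhds_zero.mp hacc (ε / 3) hε3).exists
  have hsum : Tendsto (fun n => ∑ k ∈ Finset.range (N + 1), μ ((S n ⁻¹' Y k) ∆ (S₀ ⁻¹' Y k))) l
      (𝓝 0) := by
    simpa using tendsto_finsetSum (Finset.range (N + 1)) fun k _ => h k
  filter_upwards [ENNReal.tendsto_nhds_zero.mp hsum (ε / 3) hε3] with n hn
  set D := (⋃ k, Y k) \ Set.accumulate Y N with hD
  have hDm : MeasurableSet D := (MeasurableSet.iUnion hY).diff (hYacc N)
  -- A point on which the unions disagree either meets the tail `D` under one of the maps or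
  -- separates one of the first `N + 1` sets.
  have hsub : (S n ⁻¹' ⋃ k, Y k) ∆ (S₀ ⁻¹' ⋃ k, Y k) ⊆
      (S n ⁻¹' D ∪ S₀ ⁻¹' D) ∪
        ⋃ k ∈ Finset.range (N + 1), (S n ⁻¹' Y k) ∆ (S₀ ⁻¹' Y k) := by
    intro x hx
    simp only [Set.mem_symmDiff, Set.mem_preimage, Set.mem_iUnion, Set.mem_union, hD,
      Set.mem_sdiff, Set.mem_accumulate, Finset.mem_range, Nat.lt_succ_iff] at hx ⊢
    grind
  calc μ ((S n ⁻¹' ⋃ k, Y k) ∆ (S₀ ⁻¹' ⋃ k, Y k)) ≤ _ := measure_mono hsub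
    _ ≤ (μ (S n ⁻¹' D) + μ (S₀ ⁻¹' D)) +
        ∑ k ∈ Finset.range (N + 1), μ ((S n ⁻¹' Y k) ∆ (S₀ ⁻¹' Y k)) :=
      (measure_union_le _ _).trans
        (add_le_add (measure_union_le _ _) (measure_biUnion_finset_le _ _))
    _ ≤ (ε / 3 + ε / 3) + ε / 3 := by
      rw [(hS n).measure_preimage hDm.nullMeasurableSet,
        hS₀.measure_preimage hDm.nullMeasurableSet]
      exact add_le_add (add_le_add hN hN) hn
    _ = ε := ENNReal.add_thirds ε

/-- Convergence in measure of the coordinates of measure-preserving self-maps of a product implies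
convergence in the measure algebra. -/
theorem tendsto_measure_symmDiff_preimage_of_coordinates {ι E : Type*} [PseudoEMetricSpace E]
    [MeasurableSpace E] [BorelSpace E] {ν : Measure (ι → E)} [IsFiniteMeasure ν]
    {β : Type*} {l : Filter β} {S : β → (ι → E) → (ι → E)} {S₀ : (ι → E) → (ι → E)}
    (hS : ∀ n, MeasurePreserving (S n) ν ν) (hS₀ : MeasurePreserving S₀ ν ν)
    (h : ∀ i, TendstoInMeasure ν (fun n x => S n x i) l (fun x => S₀ x i))
    {Y : Set (ι → E)} (hY : MeasurableSet Y) :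
    Tendsto (fun n => ν ((S n ⁻¹' Y) ∆ (S₀ ⁻¹' Y))) l (𝓝 0) := by
  -- The sets with convergent preimages form a σ-algebra, so closed cylinders over single
  -- coordinates suffice.
  have hm : MeasurableSpace.pi ≤ (show MeasurableSpace (ι → E) from
    { MeasurableSet' := fun Y => MeasurableSet Y ∧
        Tendsto (fun n => ν ((S n ⁻¹' Y) ∆ (S₀ ⁻¹' Y))) l (𝓝 0)
      measurableSet_empty := ⟨MeasurableSet.empty, by
        simpa using tendsto_const_nhds⟩
      measurableSet_compl := fun Y hY => ⟨hY.1.compl, by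
        simpa only [Set.preimage_compl, compl_symmDiff_compl] using hY.2⟩
      measurableSet_iUnion := fun Y hY => ⟨MeasurableSet.iUnion fun k => (hY k).1,
        tendsto_measure_symmDiff_preimage_iUnion hS hS₀ (fun k => (hY k).1) fun k => (hY k).2⟩ }) := by
    refine iSup_le fun i => ?_
    have hcomap : MeasurableSpace.comap (fun x : ι → E => x i)
          (inferInstanceAs (MeasurableSpace E)) =
        MeasurableSpace.generateFrom (Set.preimage (fun x : ι → E => x i) '' {C | IsClosed C}) := by
      rw [← MeasurableSpace.comap_generateFrom, ← borel_eq_generateFrom_isClosed,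
        ← BorelSpace.measurable_eq (α := E)]
    refine hcomap.le.trans (MeasurableSpace.generateFrom_le ?_)
    rintro _ ⟨C, hC, rfl⟩
    refine ⟨measurable_pi_apply i hC.measurableSet, ?_⟩
    refine tendsto_measure_symmDiff_preimage_of_isClosed
      (f := fun n x => S n x i) (f₀ := fun x => S₀ x i)
      (fun n => (measurable_pi_apply i).comp (hS n).measurable)
      ((measurable_pi_apply i).comp hS₀.measurable) (fun n => ?_) (h i) hC
    change ν.map ((fun x => x i) ∘ S n) = ν.map ((fun x => x i) ∘ S₀)
    rw [← Measure.map_map (measurable_pi_apply i) (hS n).measurable, (hS n).map_eq,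
      ← Measure.map_map (measurable_pi_apply i) hS₀.measurable, hS₀.map_eq]
  exact (hm Y hY).2

end Convergence

/-! ### The complex Gaussian measure. -/

section Gaussian

open ProbabilityTheory Filter Topology
open scoped ComplexConjugate

/-- The standard complex Gaussian measure, normalized to have variance `1`. -/
def complexGaussian : Measure ℂ := (stdGaussian ℂ).map fun z => (√2)⁻¹ • z

instance : IsProbabilityMeasure complexGaussian :=
  Measure.isProbabilityMeasure_map (by fun_prop)

instance : IsGaussian complexGaussian :=
  isGaussian_map ((√2)⁻¹ • ContinuousLinearMap.id ℝ ℂ)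

/-- The scaling by `(√2)⁻¹` turns the exponent `-‖t‖²/2` into `-‖t‖²/4`. Dependence on `‖t‖` alone
is the circular symmetry that makes complex coefficients harmless later. -/
theorem charFun_complexGaussian (t : ℂ) :
    charFun complexGaussian t = Complex.exp (-‖t‖ ^ 2 / 4) := by
  rw [complexGaussian, charFun_map_smul, charFun_stdGaussian, norm_smul]
  congr 1
  have h : ((√2)⁻¹ : ℝ) ^ 2 = 1 / 2 := by rw [inv_pow, Real.sq_sqrt (by norm_num)]; norm_num
  rw [Real.norm_of_nonneg (by positivity), ← Complex.ofReal_pow, mul_pow, h]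
  push_cast
  ring

theorem integral_id_complexGaussian : ∫ z, z ∂complexGaussian = 0 := by
  rw [complexGaussian, integral_map (by fun_prop) (by fun_prop), integral_smul,
    integral_id_stdGaussian, smul_zero]

theorem integral_sq_dual_stdGaussian (L : StrongDual ℝ ℂ) :
    ∫ z, L z ^ 2 ∂stdGaussian ℂ = ‖L‖ ^ 2 := by
  rw [← variance_dual_stdGaussian, variance_eq_integral (by fun_prop),
    integral_strongDual_stdGaussian]
  simp

theorem integral_norm_sq_complexGaussian : ∫ z, ‖z‖ ^ 2 ∂complexGaussian = 1 := by
  have hre := integral_sq_dual_stdGaussian Complex.reCLM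
  have him := integral_sq_dual_stdGaussian Complex.imCLM
  rw [Complex.reCLM_norm] at hre
  rw [Complex.imCLM_norm] at him
  have h : ((√2)⁻¹ : ℝ) ^ 2 = 1 / 2 := by rw [inv_pow, Real.sq_sqrt (by norm_num)]; norm_num
  rw [complexGaussian, integral_map (by fun_prop) (by fun_prop)]
  have hfun : ∀ z : ℂ, ‖((√2)⁻¹ : ℝ) • z‖ ^ 2 =
      1 / 2 * (Complex.reCLM z ^ 2 + Complex.imCLM z ^ 2) := fun z => by
    rw [norm_smul, mul_pow, Real.norm_of_nonneg (by positivity), h, Complex.sq_norm,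
      Complex.normSq_apply]
    simp [sq]
  simp only [hfun]
  rw [integral_const_mul, integral_add, hre, him]
  · norm_num
  · exact (IsGaussian.memLp_dual (stdGaussian ℂ) Complex.reCLM 2 (by norm_num)).integrable_sq
  · exact (IsGaussian.memLp_dual (stdGaussian ℂ) Complex.imCLM 2 (by norm_num)).integrable_sq

/-! ### The product measure and its coordinates. -/

variable {ι : Type*}

/-- The product of standard complex Gaussian measures. -/
def gaussianProduct (ι : Type*) : Measure (ι → ℂ) :=
  Measure.infinitePi fun _ : ι => complexGaussian

instance : IsProbabilityMeasure (gaussianProduct ι) :=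
  inferInstanceAs (IsProbabilityMeasure (Measure.infinitePi fun _ : ι => complexGaussian))

theorem measurePreserving_eval_gaussianProduct (i : ι) :
    MeasurePreserving (fun x : ι → ℂ => x i) (gaussianProduct ι) complexGaussian :=
  measurePreserving_eval_infinitePi (fun _ : ι => complexGaussian) i

theorem memLp_eval_gaussianProduct (i : ι) :
    MemLp (fun x : ι → ℂ => x i) 2 (gaussianProduct ι) :=
  (IsGaussian.memLp_two_id (μ := complexGaussian)).comp_measurePreserving
    (measurePreserving_eval_gaussianProduct i)

/-- The coordinate functions as elements of `L²`. -/
def coordLp (i : ι) : Lp ℂ 2 (gaussianProduct ι) := (memLp_eval_gaussianProduct i).toLp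

theorem coeFn_coordLp (i : ι) : coordLp i =ᵐ[gaussianProduct ι] fun x => x i :=
  MemLp.coeFn_toLp _

theorem orthonormal_coordLp : Orthonormal ℂ (coordLp (ι := ι)) := by
  refine ⟨fun i => ?_, fun i j hij => ?_⟩
  · have h : inner ℂ (coordLp i) (coordLp i) = 1 := by
      rw [L2.inner_def]
      have hae : (fun x => inner ℂ (coordLp i x) (coordLp i x)) =ᵐ[gaussianProduct ι]
          fun x => ((‖x i‖ ^ 2 : ℝ) : ℂ) := by
        filter_upwards [coeFn_coordLp i] with x hx
        rw [hx, inner_self_eq_norm_sq_to_K]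
        norm_cast
      rw [integral_congr_ae hae, integral_complex_ofReal, ← Complex.ofReal_one,
        ← integral_norm_sq_complexGaussian,
        ← (measurePreserving_eval_gaussianProduct i).map_eq,
        integral_map (measurable_pi_apply i).aemeasurable (by fun_prop)]
    have h' : ‖coordLp i‖ ^ 2 = 1 := by
      rw [norm_sq_eq_re_inner (𝕜 := ℂ), h, RCLike.one_re]
    nlinarith [norm_nonneg (coordLp i)]
  · change inner ℂ (coordLp i) (coordLp j) = 0
    rw [L2.inner_def]
    have hae : (fun x => inner ℂ (coordLp i x) (coordLp j x)) =ᵐ[gaussianProduct ι]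
        fun x => x j * conj (x i) := by
      filter_upwards [coeFn_coordLp i, coeFn_coordLp j] with x hx hx'
      rw [hx, hx']
      rfl
    have hind : iIndepFun (fun (i : ι) (x : ι → ℂ) => x i) (gaussianProduct ι) :=
      iIndepFun_infinitePi (X := fun _ z => z) (fun _ => measurable_id)
    have hind' : IndepFun (fun x : ι → ℂ => x j) (fun x : ι → ℂ => conj (x i))
        (gaussianProduct ι) :=
      (hind.indepFun hij.symm).comp measurable_id Complex.continuous_conj.measurable
    have hzero : ∫ x : ι → ℂ, x j ∂gaussianProduct ι = 0 := by
      rw [← integral_id_complexGaussian, ← (measurePreserving_eval_gaussianProduct j).map_eq,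
        integral_map (measurable_pi_apply j).aemeasurable (by fun_prop)]
    rw [integral_congr_ae hae, hind'.integral_fun_mul_eq_mul_integral
      (measurable_pi_apply j).aestronglyMeasurable
      (Complex.continuous_conj.measurable.comp (measurable_pi_apply i)).aestronglyMeasurable,
      hzero, zero_mul]

/-! ### The Gaussian process and its characteristic functional. -/

variable {K : Type*} [NormedAddCommGroup K] [InnerProductSpace ℂ K]

/-- The Gaussian process indexed by a Hilbert space with a given Hilbert basis. -/
def gaussianEmbedding (e : HilbertBasis ι ℂ K) : K →ₗᵢ[ℂ] Lp ℂ 2 (gaussianProduct ι) :=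
  orthonormal_coordLp.orthogonalFamily.linearIsometry.comp e.repr.toLinearIsometry

theorem gaussianEmbedding_basis (e : HilbertBasis ι ℂ K) (i : ι) :
    gaussianEmbedding e (e i) = coordLp i := by
  classical
  change orthonormal_coordLp.orthogonalFamily.linearIsometry (e.repr (e i)) = _
  rw [HilbertBasis.repr_self, OrthogonalFamily.linearIsometry_apply_single,
    LinearIsometry.toSpanSingleton_apply, one_smul]

theorem norm_sum_smul_sq {v : ι → K} (hv : Orthonormal ℂ v) (s : Finset ι) (a : ι → ℂ) :
    ‖∑ i ∈ s, a i • v i‖ ^ 2 = ∑ i ∈ s, ‖a i‖ ^ 2 := by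
  have h' : ∀ i, conj (a i) * a i = ((‖a i‖ ^ 2 : ℝ) : ℂ) := fun i => by
    rw [Complex.conj_mul']; norm_cast
  rw [norm_sq_eq_re_inner (𝕜 := ℂ), hv.inner_sum a a s]
  simp only [h', ← Complex.ofReal_sum]
  exact Complex.ofReal_re _

theorem real_inner_eq_conj_mul_re (z t : ℂ) : inner ℝ z t = (conj t * z).re := by
  rw [Complex.inner]
  simp

theorem integral_exp_re_mul_complexGaussian (a : ℂ) :
    ∫ z, Complex.exp ((a * z).re * Complex.I) ∂complexGaussian =
      Complex.exp (-‖a‖ ^ 2 / 4) := by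
  have h := charFun_complexGaussian (conj a)
  rw [charFun_apply] at h
  simpa [real_inner_eq_conj_mul_re] using h

theorem integral_exp_re_finsetSum (s : Finset ι) (a : ι → ℂ) :
    ∫ x, Complex.exp ((∑ i ∈ s, a i * x i).re * Complex.I) ∂gaussianProduct ι =
      Complex.exp (-(∑ i ∈ s, ‖a i‖ ^ 2 : ℝ) / 4) := by
  have hind : iIndepFun (fun (i : ι) (x : ι → ℂ) => a i * x i) (gaussianProduct ι) :=
    iIndepFun_infinitePi (X := fun i z => a i * z) (fun i => measurable_const_mul (a i))
  have hm : ∀ i, Measurable fun x : ι → ℂ => a i * x i := fun i =>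
    (measurable_const_mul (a i)).comp (measurable_pi_apply i)
  have h := iIndepFun.charFun_map_fun_finsetSum_eq_prod (s := s)
    (X := fun (i : ι) (x : ι → ℂ) => a i * x i)
    (fun i _ => (hm i).aemeasurable) (hind.restrict s)
  -- At `t = 1` the characteristic function of a complex variable is the integral of `exp(i Re z)`.
  have h₁ := congrFun h 1
  rw [charFun_apply, integral_map (Finset.measurable_fun_sum s fun i _ => hm i).aemeasurable
    (by fun_prop), Finset.prod_apply] at h₁
  simp only [real_inner_eq_conj_mul_re, map_one, one_mul] at h₁
  rw [h₁]
  have h₂ : ∀ i, charFun ((gaussianProduct ι).map fun x => a i * x i) 1 =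
      Complex.exp (-‖a i‖ ^ 2 / 4) := fun i => by
    rw [charFun_apply, integral_map (hm i).aemeasurable (by fun_prop),
      ← integral_exp_re_mul_complexGaussian, ← (measurePreserving_eval_gaussianProduct i).map_eq,
      integral_map (measurable_pi_apply i).aemeasurable (by fun_prop)]
    simp only [real_inner_eq_conj_mul_re, map_one, one_mul]
  simp only [h₂, ← Complex.exp_sum]
  congr 1
  push_cast
  rw [← Finset.sum_div, Finset.sum_neg_distrib]

theorem norm_exp_mul_I_sub_exp_mul_I_le (a b : ℝ) :
    ‖Complex.exp (a * Complex.I) - Complex.exp (b * Complex.I)‖ ≤ |a - b| := by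
  have h : Complex.exp (a * Complex.I) - Complex.exp (b * Complex.I) =
      Complex.exp (b * Complex.I) * (Complex.exp (Complex.I * (a - b : ℝ)) - 1) := by
    rw [mul_sub, mul_one, ← Complex.exp_add]
    push_cast
    ring_nf
  rw [h, norm_mul, Complex.norm_exp_ofReal_mul_I, one_mul]
  exact Real.norm_exp_I_mul_ofReal_sub_one_le

/-- The functional is 1-Lipschitz, since `exp(i·)` is 1-Lipschitz on ℝ and the L¹ norm is at most
the L² norm on a probability space. It carries the characteristic functional from finite sums of
basis vectors to all of `K`. -/
theorem continuous_integral_exp_re {X : Type*} [MeasurableSpace X] (μ : Measure X)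
    [IsProbabilityMeasure μ] :
    Continuous fun f : Lp ℂ 2 μ => ∫ x, Complex.exp ((f x).re * Complex.I) ∂μ := by
  have hint : ∀ f : Lp ℂ 2 μ, Integrable (fun x => Complex.exp ((f x).re * Complex.I)) μ := by
    intro f
    refine Integrable.of_bound (C := 1) ?_ (Eventually.of_forall fun x => ?_)
    · have : Measurable f := (Lp.stronglyMeasurable f).measurable
      exact Measurable.aestronglyMeasurable (by fun_prop)
    · rw [Complex.norm_exp_ofReal_mul_I]
  refine LipschitzWith.continuous (K := 1) (LipschitzWith.of_dist_le_mul fun f g => ?_)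
  rw [dist_eq_norm, ← integral_sub (hint f) (hint g), dist_eq_norm, NNReal.coe_one, one_mul]
  have hfg : Integrable (f - g : Lp ℂ 2 μ) μ := (Lp.memLp (f - g)).integrable (by norm_num)
  calc ‖∫ x, (Complex.exp ((f x).re * Complex.I) - Complex.exp ((g x).re * Complex.I)) ∂μ‖
      ≤ ∫ x, ‖(f - g : Lp ℂ 2 μ) x‖ ∂μ := by
        refine norm_integral_le_of_norm_le hfg.norm ?_
        filter_upwards [Lp.coeFn_sub f g] with x hx
        refine (norm_exp_mul_I_sub_exp_mul_I_le _ _).trans ?_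
        rw [hx, Pi.sub_apply, ← Complex.sub_re]
        exact Complex.abs_re_le_norm _
    _ = (eLpNorm (f - g : Lp ℂ 2 μ) 1 μ).toReal := by
        rw [eLpNorm_one_eq_lintegral_enorm, integral_norm_eq_lintegral_enorm hfg.1]
    _ ≤ (eLpNorm (f - g : Lp ℂ 2 μ) 2 μ).toReal :=
        ENNReal.toReal_mono (Lp.memLp (f - g)).2.ne
          (eLpNorm_le_eLpNorm_of_exponent_le (by norm_num) hfg.1)
    _ = ‖f - g‖ := rfl

/-- The characteristic functional of the Gaussian process. -/
theorem integral_exp_re_gaussianEmbedding (e : HilbertBasis ι ℂ K) (v : K) :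
    ∫ x, Complex.exp ((gaussianEmbedding e v x).re * Complex.I) ∂gaussianProduct ι =
      Complex.exp (-‖v‖ ^ 2 / 4) := by
  have hclosed : IsClosed {v : K |
      ∫ x, Complex.exp ((gaussianEmbedding e v x).re * Complex.I) ∂gaussianProduct ι =
        Complex.exp (-‖v‖ ^ 2 / 4)} :=
    isClosed_eq ((continuous_integral_exp_re _).comp (gaussianEmbedding e).continuous)
      (by fun_prop)
  refine hclosed.mem_of_tendsto (e.hasSum_repr v) (Eventually.of_forall fun s => ?_)
  change ∫ x, Complex.exp ((gaussianEmbedding e _ x).re * Complex.I) ∂gaussianProduct ι = _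
  have hae : gaussianEmbedding e (∑ i ∈ s, e.repr v i • e i) =ᵐ[gaussianProduct ι]
      fun x => ∑ i ∈ s, e.repr v i * x i := by
    simp only [map_sum, map_smul, gaussianEmbedding_basis]
    refine (Lp.coeFn_fun_finsetSum s _).trans ?_
    have h : ∀ᵐ x ∂gaussianProduct ι, ∀ i ∈ s,
        (e.repr v i • coordLp i : Lp ℂ 2 (gaussianProduct ι)) x = e.repr v i * x i := by
      rw [Finset.eventually_all]
      intro i _
      filter_upwards [Lp.coeFn_smul (e.repr v i) (coordLp i), coeFn_coordLp i] with x hx hx'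
      rw [hx, Pi.smul_apply, hx', smul_eq_mul]
    filter_upwards [h] with x hx
    exact Finset.sum_congr rfl hx
  refine (integral_congr_ae (hae.fun_comp fun z => Complex.exp (z.re * Complex.I))).trans ?_
  refine (integral_exp_re_finsetSum s fun i => e.repr v i).trans ?_
  rw [← norm_sum_smul_sq e.orthonormal, Complex.ofReal_pow]

/-- The self-map of the product space whose coordinates are the values of the Gaussian process at
the images of the basis vectors. -/
def gaussianMap (e : HilbertBasis ι ℂ K) (U : K →ₗᵢ[ℂ] K) (x : ι → ℂ) (i : ι) : ℂ :=
  gaussianEmbedding e (U (e i)) x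

theorem measurable_gaussianEmbedding (e : HilbertBasis ι ℂ K) (v : K) :
    Measurable (gaussianEmbedding e v) :=
  (Lp.stronglyMeasurable _).measurable

/-- The real pairing with `t` equals `Re Φ(∑ conj(tᵢ) uᵢ)`, and that vector has squared norm `∑
‖tᵢ‖²`. The resulting joint characteristic function factors, giving both the laws and the
independence below. -/
theorem integral_exp_inner_gaussianEmbedding (e : HilbertBasis ι ℂ K) {κ : Type*} {u : κ → K}
    (hu : Orthonormal ℂ u) (s : Finset κ) (t : κ → ℂ) :
    ∫ x, Complex.exp ((∑ i ∈ s, inner ℝ (gaussianEmbedding e (u i) x) (t i) : ℝ) * Complex.I)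
      ∂gaussianProduct ι = Complex.exp (-(∑ i ∈ s, ‖t i‖ ^ 2 : ℝ) / 4) := by
  have hae : (fun x => ((∑ i ∈ s, inner ℝ (gaussianEmbedding e (u i) x) (t i) : ℝ) : ℂ))
      =ᵐ[gaussianProduct ι]
      fun x => ((gaussianEmbedding e (∑ i ∈ s, conj (t i) • u i) x).re : ℂ) := by
    have h : ∀ᵐ x ∂gaussianProduct ι, ∀ i ∈ s,
        (conj (t i) • gaussianEmbedding e (u i) : Lp ℂ 2 (gaussianProduct ι)) x =
          conj (t i) * gaussianEmbedding e (u i) x := by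
      rw [Finset.eventually_all]
      intro i _
      filter_upwards [Lp.coeFn_smul (conj (t i)) (gaussianEmbedding e (u i))] with x hx
      rw [hx, Pi.smul_apply, smul_eq_mul]
    simp only [map_sum, map_smul]
    filter_upwards [h, Lp.coeFn_fun_finsetSum s
      fun i => conj (t i) • gaussianEmbedding e (u i)] with x hx hx'
    rw [hx', Complex.re_sum]
    congr 1
    refine Finset.sum_congr rfl fun i hi => ?_
    rw [hx i hi, real_inner_eq_conj_mul_re]
  refine (integral_congr_ae (hae.fun_comp fun z => Complex.exp (z * Complex.I))).trans ?_
  simp only [Function.comp_def]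
  rw [integral_exp_re_gaussianEmbedding, ← Complex.ofReal_pow, norm_sum_smul_sq hu]
  simp

theorem map_gaussianEmbedding_of_norm_eq_one (e : HilbertBasis ι ℂ K) {u : K} (hu : ‖u‖ = 1) :
    (gaussianProduct ι).map (gaussianEmbedding e u) = complexGaussian := by
  have hm := measurable_gaussianEmbedding e u
  have : IsProbabilityMeasure ((gaussianProduct ι).map (gaussianEmbedding e u)) :=
    Measure.isProbabilityMeasure_map hm.aemeasurable
  refine Measure.ext_of_charFun (funext fun t => ?_)
  have h := integral_exp_inner_gaussianEmbedding e (κ := Unit) (u := fun _ => u)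
    ⟨fun _ => hu, fun i j hij => (hij rfl).elim⟩ Finset.univ (fun _ => t)
  rw [charFun_apply, integral_map hm.aemeasurable (by fun_prop), charFun_complexGaussian]
  simpa using h

theorem iIndepFun_gaussianEmbedding (e : HilbertBasis ι ℂ K) {κ : Type*} {u : κ → K}
    (hu : Orthonormal ℂ u) :
    iIndepFun (fun i => (gaussianEmbedding e (u i) : (ι → ℂ) → ℂ)) (gaussianProduct ι) := by
  rw [iIndepFun_iff_finset]
  intro s
  have hm := fun i => measurable_gaussianEmbedding e (u i)
  refine (iIndepFun_iff_charFun_pi fun i : s => (hm i).aemeasurable).mpr ?_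
  intro t
  have ht := integral_exp_inner_gaussianEmbedding e (u := fun i : s => u i)
    (hu.comp _ Subtype.val_injective) Finset.univ t
  rw [charFun_apply, integral_map (by fun_prop) (by fun_prop)]
  simp only [PiLp.inner_apply, map_gaussianEmbedding_of_norm_eq_one e (hu.1 _),
    charFun_complexGaussian, ← Complex.exp_sum]
  rw [ht, ← Finset.sum_div, Finset.sum_neg_distrib]
  norm_cast

theorem measurePreserving_gaussianMap (e : HilbertBasis ι ℂ K) (U : K →ₗᵢ[ℂ] K) :
    MeasurePreserving (gaussianMap e U) (gaussianProduct ι) (gaussianProduct ι) := by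
  have hu : Orthonormal ℂ fun i => U (e i) := e.orthonormal.comp_linearIsometry U
  have hm := fun i => measurable_gaussianEmbedding e (U (e i))
  refine ⟨measurable_pi_iff.mpr hm, ?_⟩
  have h := (iIndepFun_gaussianEmbedding e hu).map_fun_eq_infinitePi_map hm
  refine h.trans ?_
  simp only [map_gaussianEmbedding_of_norm_eq_one e (hu.1 _)]
  rfl

/-- Both sides are continuous and linear in `v`; on basis vectors they agree by the choice of
coordinates of `gaussianMap`. -/
theorem compMeasurePreserving_gaussianEmbedding (e : HilbertBasis ι ℂ K) (U : K →ₗᵢ[ℂ] K)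
    (v : K) : Lp.compMeasurePreserving (gaussianMap e U) (measurePreserving_gaussianMap e U)
      (gaussianEmbedding e v) = gaussianEmbedding e (U v) := by
  have h : ((Lp.compMeasurePreservingₗᵢ ℂ _ (measurePreserving_gaussianMap e U)).comp
      (gaussianEmbedding e)).toContinuousLinearMap =
      ((gaussianEmbedding e).comp U).toContinuousLinearMap := by
    refine ContinuousLinearMap.ext_on (s := Set.range e)
      (Submodule.dense_iff_topologicalClosure_eq_top.mpr e.dense_span) ?_
    rintro _ ⟨i, rfl⟩
    change Lp.compMeasurePreserving (gaussianMap e U) (measurePreserving_gaussianMap e U)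
      (gaussianEmbedding e (e i)) = gaussianEmbedding e (U (e i))
    refine Lp.ext ((Lp.coeFn_compMeasurePreserving _ _).trans ?_)
    rw [gaussianEmbedding_basis]
    exact (measurePreserving_gaussianMap e U).quasiMeasurePreserving.ae_eq_comp (coeFn_coordLp i)
  exact congrArg (fun L => L v) h

/-- Each coordinate agrees off a null set; countability of `ι` allows one null set for all. The
order is reversed because the maps act on functions by composition. -/
theorem gaussianMap_comp_ae_eq [Countable ι] (e : HilbertBasis ι ℂ K) (U V : K →ₗᵢ[ℂ] K) :
    gaussianMap e U ∘ gaussianMap e V =ᵐ[gaussianProduct ι] gaussianMap e (V * U) := by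
  have h : ∀ᵐ x ∂gaussianProduct ι, ∀ i,
      gaussianEmbedding e (U (e i)) (gaussianMap e V x) =
        gaussianEmbedding e (V (U (e i))) x := by
    rw [ae_all_iff]
    intro i
    have h₁ := Lp.coeFn_compMeasurePreserving (gaussianEmbedding e (U (e i)))
      (measurePreserving_gaussianMap e V)
    rw [compMeasurePreserving_gaussianEmbedding] at h₁
    exact h₁.symm
  filter_upwards [h] with x hx
  exact funext hx

theorem gaussianMap_one_ae_eq [Countable ι] (e : HilbertBasis ι ℂ K) :
    gaussianMap e 1 =ᵐ[gaussianProduct ι] id := by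
  have h : ∀ᵐ x ∂gaussianProduct ι, ∀ i, gaussianEmbedding e (e i) x = x i := by
    rw [ae_all_iff]
    intro i
    rw [gaussianEmbedding_basis]
    exact coeFn_coordLp i
  filter_upwards [h] with x hx
  exact funext hx

/-- The class of `gaussianMap`. -/
def gaussianEnd (e : HilbertBasis ι ℂ K) (U : K →ₗᵢ[ℂ] K) : MPEnd (gaussianProduct ι) :=
  Quotient.mk _ ⟨gaussianMap e U, measurePreserving_gaussianMap e U⟩

theorem gaussianEnd_mul [Countable ι] (e : HilbertBasis ι ℂ K) (U V : K →ₗᵢ[ℂ] K) :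
    gaussianEnd e U * gaussianEnd e V = gaussianEnd e (V * U) :=
  Quotient.sound (gaussianMap_comp_ae_eq e U V)

theorem gaussianEnd_one [Countable ι] (e : HilbertBasis ι ℂ K) : gaussianEnd e 1 = 1 :=
  Quotient.sound (gaussianMap_one_ae_eq e)

theorem countable_of_hilbertBasis [TopologicalSpace.SeparableSpace K] (e : HilbertBasis ι ℂ K) :
    Countable ι := by
  refine Set.countable_univ_iff.mp (Set.PairwiseDisjoint.countable_of_isOpen
    (s := fun i => Metric.ball (e i) (1 / 2)) ?_ (fun _ _ => Metric.isOpen_ball)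
    (fun _ _ => ⟨_, Metric.mem_ball_self (by norm_num)⟩))
  intro i _ j _ hij
  refine Metric.ball_disjoint_ball ?_
  -- Distinct basis vectors are √2 apart, so balls of radius 1/2 around them are disjoint.
  have h := norm_sub_sq (𝕜 := ℂ) (e i) (e j)
  rw [e.orthonormal.1 i, e.orthonormal.1 j, e.orthonormal.2 hij] at h
  norm_num at h
  rw [dist_eq_norm]
  nlinarith [norm_nonneg (e i - e j)]

/-! ### The Gaussian action of a unitary representation. -/

variable {Ω : Type*} {G : Subgroup (Equiv.Perm Ω)} [CompleteSpace K]

/-- The isometry underlying a unitary operator, as a monoid homomorphism. -/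
def isometryHom (π : G →* unitary (K →L[ℂ] K)) : G →* (K →ₗᵢ[ℂ] K) where
  toFun g := (Unitary.linearIsometryEquiv (π g)).toLinearIsometry
  map_one' := by
    rw [map_one, map_one]; rfl
  map_mul' g h := by
    rw [map_mul, map_mul]; rfl

/-- The Gaussian action associated with a unitary representation. -/
def gaussianAction [Countable ι] (e : HilbertBasis ι ℂ K) (π : G →* unitary (K →L[ℂ] K)) :
    G →* Aut (gaussianProduct ι) where
  toFun g := show (MPEnd (gaussianProduct ι))ˣ from
    -- `gaussianEnd` reverses products, so `g⁻¹` is needed to obtain a homomorphism.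
    { val := gaussianEnd e (isometryHom π g⁻¹)
      inv := gaussianEnd e (isometryHom π g)
      val_inv := by rw [gaussianEnd_mul, ← map_mul, mul_inv_cancel, map_one, gaussianEnd_one]
      inv_val := by rw [gaussianEnd_mul, ← map_mul, inv_mul_cancel, map_one, gaussianEnd_one] }
  map_one' := Units.ext (by
    change gaussianEnd e (isometryHom π 1⁻¹) = 1
    rw [inv_one, map_one, gaussianEnd_one])
  map_mul' g h := Units.ext (by
    change gaussianEnd e (isometryHom π (g * h)⁻¹) =
      gaussianEnd e (isometryHom π g⁻¹) * gaussianEnd e (isometryHom π h⁻¹)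
    rw [gaussianEnd_mul, ← map_mul, mul_inv_rev])

theorem gaussianEmbedding_intertwines [Countable ι] (e : HilbertBasis ι ℂ K)
    (π : G →* unitary (K →L[ℂ] K)) (g : G) (v : K) :
    gaussianEmbedding e ((π g : K →L[ℂ] K) v) =
      (koopman (gaussianAction e π) g : Lp ℂ 2 (gaussianProduct ι) →L[ℂ] _)
        (gaussianEmbedding e v) :=
  (compMeasurePreserving_gaussianEmbedding e (isometryHom π g) v).symm

theorem imageDist_gaussianAction [Countable ι] (e : HilbertBasis ι ℂ K)
    (π : G →* unitary (K →L[ℂ] K)) (g : G) (Y Z : Set (ι → ℂ)) :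
    (gaussianAction e π g).imageDist Y Z =
      gaussianProduct ι ((gaussianMap e (isometryHom π g) ⁻¹' Y) ∆ Z) := rfl

theorem tendsto_measure_symmDiff_of_tendsto {X : Type*} [MeasurableSpace X] {μ : Measure X}
    [IsFiniteMeasure μ] {β : Type*} {l : Filter β} {Y : β → Set X} {Y₀ : Set X}
    (h : Tendsto (fun n => μ (Y n ∆ Y₀)) l (𝓝 0)) (Z : Set X) :
    Tendsto (fun n => μ (Y n ∆ Z)) l (𝓝 (μ (Y₀ ∆ Z))) := by
  rw [ENNReal.tendsto_nhds (measure_ne_top _ _)]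
  intro ε hε
  filter_upwards [ENNReal.tendsto_nhds_zero.mp h ε hε] with n hn
  refine ⟨tsub_le_iff_right.mpr ?_, ?_⟩
  · refine (measure_symmDiff_le Y₀ (Y n) Z).trans ?_
    rw [symmDiff_comm Y₀, add_comm]
    gcongr
  · refine (measure_symmDiff_le (Y n) Y₀ Z).trans ?_
    rw [add_comm]
    gcongr

/-- The Gaussian action of a strongly continuous representation is continuous. -/
theorem continuous_gaussianAction [Countable ι] (e : HilbertBasis ι ℂ K)
    {π : G →* unitary (K →L[ℂ] K)} (hπ : IsStronglyContinuous π) :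
    Continuous (gaussianAction e π) := by
  refine continuous_of_imageDist fun Y Z hY _ => ?_
  simp only [imageDist_gaussianAction]
  refine continuous_iff_continuousAt.mpr fun h => ?_
  refine tendsto_measure_symmDiff_of_tendsto ?_ Z
  refine tendsto_measure_symmDiff_preimage_of_coordinates
    (fun g => measurePreserving_gaussianMap e _) (measurePreserving_gaussianMap e _)
    (fun i => ?_) hY
  have hc : Tendsto (fun g => gaussianEmbedding e (isometryHom π g (e i))) (𝓝 h)
      (𝓝 (gaussianEmbedding e (isometryHom π h (e i)))) :=
    ((gaussianEmbedding e).continuous.comp (hπ (e i))).tendsto h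
  exact tendstoInMeasure_of_tendsto_Lp hc

end Gaussian

end Dissociation

end

theorem mainTheorem4 {Ω : Type v} [Countable Ω] [Infinite Ω]
    (G : Subgroup (Equiv.Perm Ω)) (hG : IsClosed (G : Set (Equiv.Perm Ω))) :
    (∀ (H : Type u) [NormedAddCommGroup H] [InnerProductSpace ℂ H] [CompleteSpace H]
        (π : G →* unitary (H →L[ℂ] H)),
        Dissociation.IsStronglyContinuous π → Dissociation.IsDissociatedRep π) ↔
    (∀ (X : Type u) [MeasurableSpace X] [StandardBorelSpace X]
        (μ : MeasureTheory.Measure X) [MeasureTheory.IsProbabilityMeasure μ]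
        (α : G →* Dissociation.Aut μ),
        Continuous α → Dissociation.IsDissociatedAction α) := by
  constructor
  · intro h X _ _ μ _ α hα
    exact (h _ _ (Dissociation.isStronglyContinuous_koopman hα)).isDissociatedAction
  · intro h H _ _ _ π hπ
    refine Dissociation.IsDissociatedRep.of_cyclicRep fun v => ?_
    have := Dissociation.separableSpace_cyclicSubspace hπ v
    -- The index type is a subset of the cyclic subspace, so `w → ℂ` stays in universe `u`;
    -- countability of `w` makes it standard Borel.
    obtain ⟨w, e, -⟩ := exists_hilbertBasis ℂ (Dissociation.cyclicSubspace π v)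
    have := Dissociation.countable_of_hilbertBasis e
    have hα := Dissociation.continuous_gaussianAction e (hπ.cyclicRep v)
    exact (h _ _ _ hα).isDissociatedRep.of_intertwiner (Dissociation.gaussianEmbedding e)
      (Dissociation.gaussianEmbedding_intertwines e _)
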